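/- **Conventions.** Let $\mathcal L$ be a finite meet-semilattice with minimal element $\hat 0$ that is atomic, i.e. every element is a join of atoms. For $\mathcal G\subseteq\mathcal L$ and $X\in\mathcal L$ let $F_{\mathcal G}(X)=\max\{Y\in\mathcal G\mid Y\le X\}$ (the set of maximal elements) be the set of factors of $X$. A subset $\mathcal G\subseteq \mathcal L\setminus\{\hat 0\}$ is a *building set* if for every $X\ne\hat 0$ with $F_{\mathcal G}(X)=\{G_1,\dots,G_k\}$ there is a poset isomorphism $\varphi_X:\prod_{j=1}^k[\hat 0,G_j]\to[\hat 0,X]$ with $\varphi_X(\hat 0,\dots,G_j,\dots,\hat 0)=G_j$ for all $j$. A subset $S\subseteq\mathcal G$ is *$\mathcal G$-nested* if for every set of at least two pairwise incomparable elements of $S$ the join exists in $\mathcal L$ and does not belong to $\mathcal G$. The $\mathcal G$-nested sets (including $\emptyset$), ordered by inclusion, form the face poset of the nested set complex $\mathcal N(\mathcal L,\mathcal G)$. For $X\in\mathcal L$ let $v_X\in\mathbb R^{\{\text{atoms of }\mathcal L\}}$ be the vector whose coordinate at an atom $A$ is $1$ if $A\le X$ and $0$ otherwise; for $S\subseteq\mathcal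 L$ let $V(S)$ be the cone spanned by $\{v_X\mid X\in S\}$, and let $\Sigma(\mathcal L,\mathcal G)=\{V(S)\mid S \text{ is } \mathcal G\text{-nested}\}$; its face poset is the set of its cones ordered by inclusion. For a fan $\Sigma$, a cone $\{0\}\neq\sigma\in\Sigma$ and a vector $v$ in the relative interior of $\sigma$, the *stellar subdivision* $\mathrm{st}(\Sigma,\sigma,v)$ consists of the cones of $\Sigma$ that do not contain $\sigma$, together with the cones $\rho+\mathbb R_{\ge0}v$, where $\rho\in\Sigma$ does not contain $\sigma$ and is a face of some $\tau\in\Sigma$ containing $\sigma$. For a poset $P$ and $x\in P$, the *combinatorial blowup* $\mathrm{Bl}_xP$ is the poset of all $y\in P$ with $y\not\ge x$ and all $\hat y$ with $y\in P$, $y\not\ge x$, such that $y\vee x$ exists in $P$; here $y\le z$, $\hat y\le\hat z$ and $y\le\hat z$ each hold if and only if $y\le z$ in $P$, and $\hat y\le z$ never holds. **Theorem.** Let $\mathcal L$ be a finite atomic meet-semilattice and let $\mathcal H\subseteq\mathcal G$ be building sets in $\mathcal L$. Then there is a sequence of building sets $\mathcal H=\mathcal B_0\subseteq\mathcal B_1\subseteq\dots\subseteq\mathcal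 B_t=\mathcal G$ such that every $\Sigma(\mathcal L,\mathcal B_i)$, $0\le i\le t$, is a simplicial fan and for every $0\le i<t$ there is an element $X$ with the following properties. 1. $X$ is a minimal element of $\mathcal B_{i+1}\setminus\mathcal H$, and $\mathcal B_i=\mathcal B_{i+1}\setminus\{X\}$. 2. $V(F_{\mathcal H}(X))$ is a nonzero cone of $\Sigma(\mathcal L,\mathcal B_i)$, the vector $v_X$ lies in its relative interior, and $\Sigma(\mathcal L,\mathcal B_{i+1})=\mathrm{st}\big(\Sigma(\mathcal L,\mathcal B_i),V(F_{\mathcal H}(X)),v_X\big)$. 3. The face poset of $\Sigma(\mathcal L,\mathcal B_{i+1})$ is the combinatorial blowup of the face poset of $\Sigma(\mathcal L,\mathcal B_i)$ in $V(F_{\mathcal H}(X))$, via the poset isomorphism $\tau\mapsto\tau$, $\hat\tau\mapsto\tau+\mathbb R_{\ge0}v_X$. 4. The set $F_{\mathcal H}(X)$ is $\mathcal B_i$-nested, and the face poset of $\mathcal N(\mathcal L,\mathcal B_{i+1})$ is the combinatorial blowup of the face poset of $\mathcal N(\mathcal L,\mathcal B_i)$ in $F_{\mathcal H}(X)$, via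 the poset isomorphism $S\mapsto S$, $\hat S\mapsto S\cup\{X\}$. In particular, $\Sigma(\mathcal L,\mathcal G)$ is obtained from $\Sigma(\mathcal L,\mathcal H)$ by a sequence of stellar subdivisions, and the two fans have the same support: $\bigcup_{\sigma\in\Sigma(\mathcal L,\mathcal G)}\sigma=\bigcup_{\sigma\in\Sigma(\mathcal L,\mathcal H)}\sigma$. -/

import Mathlib

namespace NestedSetFan

section Combinatorics

variable {L : Type*}

/-- `max 𝒢_{≤ X}`: the maximal elements of `{Y ∈ 𝒢 | Y ≤ X}`, the set of factors of `X` in `𝒢`. -/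
def factors [PartialOrder L] (𝒢 : Set L) (X : L) : Set L :=
  {Y | Maximal (fun Z => Z ∈ 𝒢 ∧ Z ≤ X) Y}

open Classical in
/-- `𝒢 ⊆ L_{> 0}` is a building set: for every `X > 0` with factors `G₁, …, G_k` there is an
isomorphism of posets `φ : ∏ j, [0, G_j] ≃ [0, X]` with `φ (0, …, G_j, …, 0) = G_j` for all `j`.
The interval `[0, Y]` is `Set.Iic Y`; its bottom element is `0` and its top element is `Y`. -/
def IsBuildingSet [PartialOrder L] [OrderBot L] (𝒢 : Set L) : Prop :=
  ⊥ ∉ 𝒢 ∧ ∀ X : L, X ≠ ⊥ →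
    ∃ φ : (∀ g : factors 𝒢 X, Set.Iic (g : L)) ≃o Set.Iic X,
      ∀ g : factors 𝒢 X, (φ (Function.update ⊥ g ⊤) : L) = g

/-- `S ⊆ 𝒢` is `𝒢`-nested: for every set of at least two pairwise incomparable elements of `S`,
the join exists in `L` and does not belong to `𝒢`. -/
def IsNested [PartialOrder L] (𝒢 S : Set L) : Prop :=
  S ⊆ 𝒢 ∧ ∀ A : Set L, A ⊆ S → A.Nontrivial → IsAntichain (· ≤ ·) A →
    ∃ J : L, IsLUB A J ∧ J ∉ 𝒢

/-- The face poset of the nested set complex: the nested sets (including the empty one), ordered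
by inclusion. -/
abbrev NestedSet [PartialOrder L] (𝒢 : Set L) : Type _ := {S : Set L // IsNested 𝒢 S}

end Combinatorics

section Blowup

variable {P : Type*} [PartialOrder P]

/-- The combinatorial blowup `Bl_x P`. The pair `(y, false)` stands for the element `y`, the pair
`(y, true)` for the element `ŷ`, which is present only if `y ∨ x` exists. The order is the one
inherited from the product `P × Bool` with `false < true`, that is, `y ≤ z`, `ŷ ≤ ẑ` and `y ≤ ẑ`
each hold exactly if `y ≤ z` in `P`, and `ŷ ≤ z` never holds. -/
abbrev Blowup (x : P) : Type _ :=
  {p : P × Bool // ¬ x ≤ p.1 ∧ (p.2 = true → ∃ z, IsLUB {p.1, x} z)}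

/-- The element `y` of the blowup. -/
def Blowup.base {x : P} (y : P) (hy : ¬ x ≤ y) : Blowup x :=
  ⟨(y, false), hy, fun h => absurd h Bool.false_ne_true⟩

/-- The element `ŷ` of the blowup. -/
def Blowup.hat {x : P} (y : P) (hy : ¬ x ≤ y) (hyx : ∃ z, IsLUB {y, x} z) : Blowup x :=
  ⟨(y, true), hy, fun _ => hyx⟩

end Blowup

section Fans

variable {E : Type*} [AddCommGroup E] [Module ℝ E]

/-- A simplicial fan: a finite nonempty collection of simplicial cones that contains every face of
each of its members, and in which any two members meet in a common face of both. -/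
structure IsSimplicialFan (Φ : Set (PointedCone ℝ E)) : Prop where
  finite : Φ.Finite
  nonempty : Φ.Nonempty
  simplicial : ∀ σ ∈ Φ, σ.IsSimplicial
  face_mem : ∀ σ ∈ Φ, ∀ τ : PointedCone ℝ E, τ.IsFaceOf σ → τ ∈ Φ
  inter_face : ∀ σ ∈ Φ, ∀ τ ∈ Φ, (σ ⊓ τ).IsFaceOf σ ∧ (σ ⊓ τ).IsFaceOf τ

/-- The support of a collection of cones, the union of its members. -/
def support (Φ : Set (PointedCone ℝ E)) : Set E := ⋃ σ ∈ Φ, (σ : Set E)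

/-- The cone spanned by a cone `τ` and a vector `v`. -/
noncomputable def joinRay (τ : PointedCone ℝ E) (v : E) : PointedCone ℝ E :=
  τ ⊔ PointedCone.hull ℝ {v}

/-- The collection of cones `st(Φ, σ, v)`: the members of `Φ` that contain `σ` are removed and
replaced by the cones spanned by `v` and a face `ρ` of such a member with `ρ ⊉ σ`. (A member of a
fan is contained in another one exactly if it is a face of it.) -/
def stellar (Φ : Set (PointedCone ℝ E)) (σ : PointedCone ℝ E) (v : E) : Set (PointedCone ℝ E) :=
  {τ | τ ∈ Φ ∧ ¬ σ ≤ τ} ∪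
    {κ | ∃ τ ∈ Φ, σ ≤ τ ∧ ∃ ρ ∈ Φ, ρ ≤ τ ∧ ¬ σ ≤ ρ ∧ κ = joinRay ρ v}

/-- `Ψ` is the stellar subdivision of `Φ` in the nonzero cone `σ ∈ Φ` along the ray spanned by a
vector `v` in the relative interior of `σ`. -/
structure IsStellarSubdivision [TopologicalSpace E]
    (Φ : Set (PointedCone ℝ E)) (σ : PointedCone ℝ E) (v : E) (Ψ : Set (PointedCone ℝ E)) :
    Prop where
  mem : σ ∈ Φ
  ne_bot : σ ≠ ⊥
  relint : v ∈ intrinsicInterior ℝ (σ : Set E)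
  eq : Ψ = stellar Φ σ v

end Fans

section NestedFans

variable {L : Type*} [PartialOrder L] [OrderBot L]

/-- The characteristic vector `v_X`: its coordinate at an atom `A` is `1` if `A ≤ X`, else `0`. -/
noncomputable def charVec (X : L) : {A : L // IsAtom A} → ℝ :=
  Set.indicator {A | (A : L) ≤ X} 1

/-- `V(S)`, the cone spanned by the vectors `v_X` with `X ∈ S`. -/
noncomputable def cone (S : Set L) : PointedCone ℝ ({A : L // IsAtom A} → ℝ) :=
  PointedCone.hull ℝ (charVec '' S)

/-- `Σ(L, 𝒢)`, the collection of the cones `V(S)` over all `𝒢`-nested sets `S`. -/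
def nestedFan (𝒢 : Set L) : Set (PointedCone ℝ ({A : L // IsAtom A} → ℝ)) :=
  {σ | ∃ S : Set L, IsNested 𝒢 S ∧ σ = cone S}

end NestedFans

end NestedSetFan

/-! A building set enters only through two consequences of its product decompositions: an atom below
`X` lies below a factor of `X`, and elements below the factors can be glued to one element below `X`
with these meets. In the atomistic case they suffice (`isBuildingSet_of_atoms`), and the local
isomorphism is `Y ↦ (Y ⊓ g)_g`.

Fan property: the maximal elements of a nested set are the factors of its join
(`IsNested.factors_eq`). The positive coordinates of a nonnegative combination of `v_Y`, with `Y` in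
a nested set, are the atoms below that join. So the vector determines the join, hence the maximal
elements, and after subtraction of common parts all coefficients. This uniqueness,
`IsConicRealization`, makes the cones a simplicial fan with the nested sets as face poset.

One step: let `X ∉ B`, let `B` and `B ∪ {X}` be building sets, and let `F` be the factors of `X` in
`B`. For `X ∉ S`, the set `S` is nested for `B ∪ {X}` iff it is nested for `B` and `F ⊄ S`; and `S ∪
{X}` is nested for `B ∪ {X}` iff `F ⊄ S` and `S ∪ F` is nested for `B`. This is the blowup in the
face `F`. Since `v_X` is the sum of `v_f` over `f ∈ F`, it is also a stellar subdivision of the fan.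

Chain: removing a minimal element `X` of `G \ H` keeps the building property, because only members
of `H` lie strictly below `X` in `G`, and the decomposition of `X` by `H` refines any decomposition
that involves `X`. -/

namespace NestedSetFan

/-! ### Simplicial fans from unique nonnegative representations. -/

section ConicRealization

variable {ι E : Type*} [Fintype ι] [AddCommGroup E] [Module ℝ E]

theorem mem_hull_image_iff {v : ι → E} {S : Set ι} {x : E} :
    x ∈ PointedCone.hull ℝ (v '' S) ↔
      ∃ c : ι → ℝ, 0 ≤ c ∧ Function.support c ⊆ S ∧ ∑ i, c i • v i = x := by
  classical
  constructor
  · intro hx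
    induction hx using Submodule.span_induction with
    | mem x hx =>
      obtain ⟨i, hi, rfl⟩ := hx
      refine ⟨Pi.single i 1, by simp [Pi.single_nonneg], ?_, ?_⟩
      · exact Pi.support_single_subset.trans (by simpa using hi)
      · simp [Pi.single_apply]
    | zero => exact ⟨0, le_rfl, by simp, by simp⟩
    | add x y _ _ hx hy =>
      obtain ⟨c, hc, hcS, rfl⟩ := hx
      obtain ⟨d, hd, hdS, rfl⟩ := hy
      exact ⟨c + d, add_nonneg hc hd,
        (Function.support_add c d).trans (Set.union_subset hcS hdS),
        by simp [add_smul, Finset.sum_add_distrib]⟩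
    | smul r x _ hx =>
      obtain ⟨c, hc, hcS, rfl⟩ := hx
      refine ⟨fun i => r.1 * c i, fun i => mul_nonneg r.2 (hc i), ?_, ?_⟩
      · intro i hi
        exact hcS (right_ne_zero_of_mul hi)
      · simp only [Finset.smul_sum, mul_smul]
        rfl
  · rintro ⟨c, hc, hS, rfl⟩
    refine Submodule.sum_mem _ fun i _ => ?_
    by_cases h : c i = 0
    · simp [h]
    · exact Submodule.smul_mem _ (⟨c i, hc i⟩ : {r : ℝ // 0 ≤ r})
        (Submodule.subset_span ⟨i, hS h, rfl⟩)

/-- A family `K` of sets together with vectors `v` realizes a simplicial fan: the family is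
closed under passing to subsets, and a vector is a nonnegative combination of the `v i` with
support in `K` in at most one way. -/
structure IsConicRealization (K : Set (Set ι)) (v : ι → E) : Prop where
  empty_mem : ∅ ∈ K
  mono : ∀ ⦃S T : Set ι⦄, T ∈ K → S ⊆ T → S ∈ K
  inj : ∀ ⦃c d : ι → ℝ⦄, 0 ≤ c → 0 ≤ d → Function.support c ∈ K → Function.support d ∈ K →
    ∑ i, c i • v i = ∑ i, d i • v i → c = d

namespace IsConicRealization

variable {K : Set (Set ι)} {v : ι → E} {S T : Set ι}

/-- A representation over `T` of the same vector must be the given one. Containments, intersections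
and faces of the cones all reduce to this. -/
theorem mem_of_mem_hull (h : IsConicRealization K v) (hS : S ∈ K) (hT : T ∈ K) {c : ι → ℝ}
    (hc : 0 ≤ c) (hcS : Function.support c ⊆ S)
    (hx : ∑ i, c i • v i ∈ PointedCone.hull ℝ (v '' T)) : Function.support c ⊆ T := by
  obtain ⟨d, hd, hdT, hcd⟩ := mem_hull_image_iff.1 hx
  rwa [← h.inj hd hc (h.mono hT hdT) (h.mono hS hcS) hcd]

theorem hull_le_hull_iff (h : IsConicRealization K v) (hS : S ∈ K) (hT : T ∈ K) :
    PointedCone.hull ℝ (v '' S) ≤ PointedCone.hull ℝ (v '' T) ↔ S ⊆ T := by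
  classical
  refine ⟨fun hle i hi => ?_, fun hST => Submodule.span_mono (Set.image_mono hST)⟩
  have hsub : Function.support (Pi.single i (1 : ℝ)) ⊆ S :=
    Pi.support_single_subset.trans (by simpa using hi)
  have hx : ∑ j, (Pi.single i (1 : ℝ) : ι → ℝ) j • v j ∈ PointedCone.hull ℝ (v '' T) := by
    simpa [Pi.single_apply] using hle (Submodule.subset_span ⟨i, hi, rfl⟩)
  exact h.mem_of_mem_hull hS hT (by simp [Pi.single_nonneg]) hsub hx (by simp)

/-- In a linear relation, the positive and negative parts of the coefficients represent the same
vector; uniqueness makes them equal, so both vanish. -/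
theorem linearIndepOn (h : IsConicRealization K v) (hS : S ∈ K) : LinearIndepOn ℝ v S := by
  classical
  rw [LinearIndepOn, Fintype.linearIndependent_iff]
  intro g hg
  set c : ι → ℝ := fun i => if hi : i ∈ S then g ⟨i, hi⟩ else 0 with hc
  have hsum : ∑ i, c i • v i = 0 := by
    rw [← hg, ← Finset.sum_subset (Finset.subset_univ S.toFinset),
      Finset.sum_subtype _ (fun _ => Set.mem_toFinset)]
    · exact Finset.sum_congr rfl fun i _ => by simp [hc, i.2]
    · intro i _ hi
      simp [hc, show i ∉ S by simpa using hi]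
  have hsupp : Function.support c ⊆ S := fun i hi => by
    by_contra hiS
    exact hi (by simp [hc, hiS])
  have hpos := h.inj (c := c⁺) (d := c⁻) (posPart_nonneg c) (negPart_nonneg c)
    (h.mono hS fun i hi => hsupp fun h0 => hi (by simp [h0]))
    (h.mono hS fun i hi => hsupp fun h0 => hi (by simp [h0]))
    (by rw [← sub_eq_zero, ← Finset.sum_sub_distrib, ← hsum]
        refine Finset.sum_congr rfl fun i _ => ?_
        rw [← sub_smul, ← Pi.sub_apply, posPart_sub_negPart])
  have hc0 : c = 0 := by rw [← posPart_sub_negPart c, hpos, sub_self]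
  rintro ⟨i, hi⟩
  simpa [hc, hi] using congrFun hc0 i

theorem hull_inf_hull (h : IsConicRealization K v) (hS : S ∈ K) (hT : T ∈ K) :
    PointedCone.hull ℝ (v '' S) ⊓ PointedCone.hull ℝ (v '' T) =
      PointedCone.hull ℝ (v '' (S ∩ T)) := by
  apply le_antisymm
  · rintro x ⟨hxS, hxT⟩
    obtain ⟨c, hc, hcS, rfl⟩ := mem_hull_image_iff.1 hxS
    exact mem_hull_image_iff.2
      ⟨c, hc, Set.subset_inter hcS (h.mem_of_mem_hull hS hT hc hcS hxT), rfl⟩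
  · exact le_inf (Submodule.span_mono (Set.image_mono Set.inter_subset_left))
      (Submodule.span_mono (Set.image_mono Set.inter_subset_right))

theorem isFaceOf (h : IsConicRealization K v) (hT : T ∈ K) (hST : S ⊆ T) :
    (PointedCone.hull ℝ (v '' S)).IsFaceOf (PointedCone.hull ℝ (v '' T)) := by
  refine .of_mem_of_add_mem_left (Submodule.span_mono (Set.image_mono hST)) ?_
  intro x y hx hy hxy
  obtain ⟨c, hc, hcT, rfl⟩ := mem_hull_image_iff.1 hx
  obtain ⟨d, hd, hdT, rfl⟩ := mem_hull_image_iff.1 hy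
  rw [← Finset.sum_add_distrib, Finset.sum_congr rfl fun i _ => (add_smul (c i) (d i) (v i)).symm]
    at hxy
  have hsub := h.mem_of_mem_hull hT (h.mono hT hST) (c := c + d) (add_nonneg hc hd)
    ((Function.support_add c d).trans (Set.union_subset hcT hdT)) hxy
  refine mem_hull_image_iff.2 ⟨c, hc, fun i hi => hsub ?_, rfl⟩
  exact (add_pos_of_pos_of_nonneg ((hc i).lt_of_ne' hi) (hd i)).ne'

/-- A face that contains a sum of elements of the cone contains each summand, so it contains every
generator used with positive coefficient. -/
theorem eq_hull_of_isFaceOf {τ : PointedCone ℝ E}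
    (hτ : τ.IsFaceOf (PointedCone.hull ℝ (v '' S))) :
    τ = PointedCone.hull ℝ (v '' {i ∈ S | v i ∈ τ}) := by
  apply le_antisymm
  · intro x hx
    obtain ⟨c, hc, hcS, rfl⟩ := mem_hull_image_iff.1 (hτ.le hx)
    refine mem_hull_image_iff.2 ⟨c, hc, fun i hi => ⟨hcS hi, ?_⟩, rfl⟩
    have hmem : ∀ j, c j • v j ∈ PointedCone.hull ℝ (v '' S) := fun j => by
      by_cases hj : c j = 0
      · simp [hj]
      · exact PointedCone.smul_mem _ (hc j) (Submodule.subset_span ⟨j, hcS hj, rfl⟩)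
    have hi' := hτ.mem_of_sum_mem hmem hx i
    have := PointedCone.smul_mem τ (inv_nonneg.2 (hc i)) hi'
    rwa [smul_smul, inv_mul_cancel₀ hi, one_smul] at this
  · rw [PointedCone.hull, Submodule.span_le]
    rintro _ ⟨i, hi, rfl⟩
    exact hi.2

theorem isSimplicialFan (h : IsConicRealization K v) :
    IsSimplicialFan {σ | ∃ S : Set ι, S ∈ K ∧ σ = PointedCone.hull ℝ (v '' S)} where
  finite := (Set.finite_range fun S : Set ι => PointedCone.hull ℝ (v '' S)).subset
    fun _ ⟨S, _, hσ⟩ => ⟨S, hσ.symm⟩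
  nonempty := ⟨_, ∅, h.empty_mem, rfl⟩
  simplicial := by
    rintro _ ⟨S, hS, rfl⟩
    exact .hull (Set.toFinite _) (h.linearIndepOn hS).id_image
  face_mem := by
    rintro _ ⟨S, hS, rfl⟩ τ hτ
    exact ⟨_, h.mono hS (Set.sep_subset _ _), eq_hull_of_isFaceOf hτ⟩
  inter_face := by
    rintro _ ⟨S, hS, rfl⟩ _ ⟨T, hT, rfl⟩
    rw [h.hull_inf_hull hS hT]
    exact ⟨h.isFaceOf hS Set.inter_subset_left, h.isFaceOf hT Set.inter_subset_right⟩

end IsConicRealization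

theorem sum_mem_intrinsicInterior [TopologicalSpace E] [IsTopologicalAddGroup E]
    [ContinuousSMul ℝ E] [T2Space E] [FiniteDimensional ℝ E] {v : ι → E} {S : Set ι}
    (hv : LinearIndepOn ℝ v S) {c : ι → ℝ} (hcS : Function.support c ⊆ S)
    (hpos : ∀ i ∈ S, 0 < c i) :
    ∑ i, c i • v i ∈ intrinsicInterior ℝ (PointedCone.hull ℝ (v '' S) : Set E) := by
  classical
  have hc : 0 ≤ c := fun i => by
    by_cases hi : i ∈ S
    · exact (hpos i hi).le
    · exact (Function.notMem_support.1 fun h => hi (hcS h)).ge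
  obtain ⟨f, hf⟩ : ∃ f : ι → E →ₗ[ℝ] ℝ, ∀ i ∈ S, ∀ j ∈ S, f i (v j) = if i = j then 1 else 0 := by
    obtain ⟨g, hg⟩ := LinearMap.exists_leftInverse_of_injective _
      (LinearMap.ker_eq_bot.2 (linearIndependent_iff_injective_finsuppLinearCombination.1 hv))
    refine ⟨fun i => if hi : i ∈ S then Finsupp.lapply ⟨i, hi⟩ ∘ₗ g else 0, fun i hi j hj => ?_⟩
    have hgj : g (v j) = Finsupp.single ⟨j, hj⟩ 1 := by
      simpa using LinearMap.congr_fun hg (Finsupp.single ⟨j, hj⟩ 1)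
    simp [hi, hgj, Finsupp.single_apply, eq_comm]
  have hspan : ∀ x ∈ Submodule.span ℝ (v '' S), x = ∑ i, (if i ∈ S then f i x else 0) • v i := by
    intro x hx
    induction hx using Submodule.span_induction with
    | mem x hx =>
      obtain ⟨j, hj, rfl⟩ := hx
      rw [Finset.sum_eq_single j]
      · simp [hj, hf j hj j hj]
      · intro i _ hij
        by_cases hi : i ∈ S
        · simp [hi, hf i hi j hj, hij]
        · simp [hi]
      · simp
    | zero => simp
    | add x y _ _ hx hy =>
      conv_lhs => rw [hx, hy]
      rw [← Finset.sum_add_distrib]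
      refine Finset.sum_congr rfl fun i _ => ?_
      split_ifs <;> simp [add_smul]
    | smul r x _ hx =>
      conv_lhs => rw [hx]
      rw [Finset.smul_sum]
      refine Finset.sum_congr rfl fun i _ => ?_
      split_ifs <;> simp [mul_smul]
  have hle : ∀ x ∈ affineSpan ℝ (PointedCone.hull ℝ (v '' S) : Set E),
      x ∈ Submodule.span ℝ (v '' S) := by
    intro x hx
    have hsub : affineSpan ℝ (PointedCone.hull ℝ (v '' S) : Set E) ≤
        (Submodule.span ℝ (v '' S)).toAffineSubspace := by
      rw [affineSpan_le]
      intro y hy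
      obtain ⟨d, -, hdS, rfl⟩ := mem_hull_image_iff.1 hy
      refine Submodule.sum_mem _ fun i _ => ?_
      by_cases hi : d i = 0
      · simp [hi]
      · exact Submodule.smul_mem _ _ (Submodule.subset_span ⟨i, hdS hi, rfl⟩)
    exact hsub hx
  have hmem : ∑ i, c i • v i ∈ PointedCone.hull ℝ (v '' S) :=
    mem_hull_image_iff.2 ⟨c, hc, hcS, rfl⟩
  rw [mem_intrinsicInterior]
  refine ⟨⟨_, subset_affineSpan ℝ _ hmem⟩, ?_, rfl⟩
  rw [mem_interior]
  -- Where all dual functionals `f i`, `i ∈ S`, are positive, the expansion `hspan` has nonnegative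
  -- coefficients. This is thus an open part of the affine span that lies in the cone.
  refine ⟨Subtype.val ⁻¹' {x | ∀ i ∈ S, 0 < f i x}, ?_, ?_, ?_⟩
  · rintro ⟨x, hx⟩ hxpos
    refine mem_hull_image_iff.2
      ⟨fun i => if i ∈ S then f i x else 0, fun i => ?_, fun i hi => ?_, (hspan x (hle x hx)).symm⟩
    · by_cases hi : i ∈ S
      · simpa [hi] using (hxpos i hi).le
      · simp [hi]
    · by_contra hiS
      simp [hiS] at hi
  · refine IsOpen.preimage continuous_subtype_val ?_
    simp only [Set.ofPred_forall]
    exact Set.Finite.isOpen_biInter (Set.toFinite _) fun i _ =>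
      isOpen_lt continuous_const (f i).continuous_of_finiteDimensional
  · intro i hi
    have : f i (∑ j, c j • v j) = c i := by
      rw [map_sum, Finset.sum_eq_single i]
      · simp [hf i hi i hi]
      · intro j _ hji
        by_cases hj : c j = 0
        · simp [hj]
        · simp [hf i hi j (hcS hj), hji.symm]
      · simp
    simpa [this] using hpos i hi

end ConicRealization

/-! ### Factors of an element. -/

section Factors

theorem exists_isLUB_of_bddAbove {L : Type*} [SemilatticeInf L] [Finite L] {A : Set L}
    (hA : BddAbove A) : ∃ J, IsLUB A J := by
  have hne : (Set.toFinite (upperBounds A)).toFinset.Nonempty :=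
    (Set.Finite.toFinset_nonempty _).2 hA
  refine ⟨_, fun a ha => Finset.le_inf' hne id fun b hb => ?_, fun b hb => ?_⟩
  · exact (by simpa using hb : b ∈ upperBounds A) ha
  · exact Finset.inf'_le id (by simpa using hb)

theorem exists_le_factor {L : Type*} [PartialOrder L] [Finite L] {G : Set L} {X Y : L}
    (hY : Y ∈ G) (hYX : Y ≤ X) : ∃ g ∈ factors G X, Y ≤ g := by
  obtain ⟨g, hYg, hg⟩ := (Set.toFinite {Z | Z ∈ G ∧ Z ≤ X}).exists_le_maximal ⟨hY, hYX⟩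
  exact ⟨g, hg, hYg⟩

theorem mem_factors {L : Type*} [PartialOrder L] {G : Set L} {X Y : L} :
    Y ∈ factors G X ↔ (Y ∈ G ∧ Y ≤ X) ∧ ∀ Z ∈ G, Z ≤ X → Y ≤ Z → Z ≤ Y :=
  ⟨fun h => have h : Maximal (fun Z => Z ∈ G ∧ Z ≤ X) Y := h
      ⟨h.prop, fun _ hZ hZX => h.2 ⟨hZ, hZX⟩⟩,
    fun h => ⟨h.1, fun Z hZ => h.2 Z hZ.1 hZ.2⟩⟩

theorem factors_subset {L : Type*} [PartialOrder L] {G : Set L} {X : L} : factors G X ⊆ G :=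
  fun _ hg => (mem_factors.1 hg).1.1

theorem le_of_mem_factors {L : Type*} [PartialOrder L] {G : Set L} {X g : L}
    (hg : g ∈ factors G X) : g ≤ X :=
  (mem_factors.1 hg).1.2

theorem eq_of_mem_factors {L : Type*} [PartialOrder L] {G : Set L} {X Y g : L}
    (hg : g ∈ factors G X) (hY : Y ∈ G) (hYX : Y ≤ X) (hgY : g ≤ Y) : g = Y :=
  hgY.antisymm ((mem_factors.1 hg).2 Y hY hYX hgY)

theorem isAntichain_factors {L : Type*} [PartialOrder L] (G : Set L) (X : L) :
    IsAntichain (· ≤ ·) (factors G X) :=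
  setOfPred_maximal_antichain _

theorem factors_of_mem {L : Type*} [PartialOrder L] {G : Set L} {X : L} (hX : X ∈ G) :
    factors G X = {X} := by
  ext g
  refine ⟨fun hg => ?_, ?_⟩
  · exact eq_of_mem_factors hg hX le_rfl (le_of_mem_factors hg)
  · rintro rfl
    exact mem_factors.2 ⟨⟨hX, le_rfl⟩, fun _ _ hYX _ => hYX⟩

/-- By minimality of `X`, the elements of `G` strictly below `X` all lie in `H`. -/
theorem factors_diff_singleton {L : Type*} [PartialOrder L] {G H : Set L} {X : L}
    (hHG : H ⊆ G) (hX : Minimal (fun Y => Y ∈ G \ H) X) :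
    factors (G \ {X}) X = factors H X := by
  have : ∀ Y, (Y ∈ G \ {X} ∧ Y ≤ X) ↔ (Y ∈ H ∧ Y ≤ X) := by
    intro Y
    refine and_congr_left fun hYX => ⟨fun hY => ?_, fun hY => ⟨hHG hY, ?_⟩⟩
    · by_contra hYH
      exact hY.2 (hX.eq_of_le ⟨hY.1, hYH⟩ hYX)
    · rintro rfl
      exact hX.prop.2 hY
  ext Y
  simp only [factors, Set.mem_ofPred_eq, this]

end Factors

/-! ### Building sets through atoms and gluing. -/

section BuildingSet

variable {L : Type*} [SemilatticeInf L] [OrderBot L] {G H : Set L} {X Y : L}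

namespace IsBuildingSet

/-- The atom corresponds to a tuple with some nonzero entry. Setting the other entries to zero gives
a nonzero element below the atom, hence the atom itself, and it lies below the factor of that entry.
-/
theorem exists_atom_le_factor (hG : IsBuildingSet G) {a : L} (ha : IsAtom a) (haX : a ≤ X) :
    ∃ g ∈ factors G X, a ≤ g := by
  classical
  have hX : X ≠ ⊥ := by
    rintro rfl
    exact ha.1 (le_bot_iff.1 haX)
  obtain ⟨φ, hφ⟩ := hG.2 X hX
  set p := φ.symm ⟨a, haX⟩ with hp
  have hφp : φ p = ⟨a, haX⟩ := φ.apply_symm_apply _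
  have hp0 : p ≠ ⊥ := by
    intro h0
    have : (⟨a, haX⟩ : Set.Iic X) = ⊥ := by rw [← hφp, h0, map_bot]
    exact ha.1 (congrArg Subtype.val this)
  obtain ⟨g, hg⟩ : ∃ g, p g ≠ ⊥ := by
    by_contra! h
    exact hp0 (funext h)
  refine ⟨g, g.2, ?_⟩
  have hle : Function.update ⊥ g (p g) ≤ p := by
    rw [update_le_iff]
    exact ⟨le_rfl, fun _ _ => bot_le⟩
  have hne : ((φ (Function.update ⊥ g (p g)) : Set.Iic X) : L) ≠ ⊥ := by
    intro h0
    have h1 : φ (Function.update ⊥ g (p g)) = φ ⊥ := by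
      rw [map_bot]
      exact Subtype.ext h0
    have h2 := congrFun (φ.injective h1) g
    rw [Function.update_self] at h2
    exact hg h2
  have hlea : ((φ (Function.update ⊥ g (p g)) : Set.Iic X) : L) ≤ a := by
    have := φ.monotone hle
    rw [hφp] at this
    exact this
  rw [← hφ g, ← (ha.le_iff.1 hlea).resolve_left hne]
  refine φ.monotone ?_
  rw [update_le_update_iff']
  exact le_top

/-- `Y` takes its `g`-th entry from the tuple of `y g`. Meeting with `g` keeps only that entry, and
`y g ≤ g` has no other nonzero entry. -/
theorem exists_inf_factor_eq (hG : IsBuildingSet G) (hX : X ≠ ⊥) {y : L → L}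
    (hy : ∀ g ∈ factors G X, y g ≤ g) : ∃ Y ≤ X, ∀ g ∈ factors G X, Y ⊓ g = y g := by
  classical
  obtain ⟨φ, hφ⟩ := hG.2 X hX
  have hyX : ∀ g : factors G X, y g ≤ X := fun g => (hy g g.2).trans (le_of_mem_factors g.2)
  set p : ∀ g : factors G X, Set.Iic (g : L) := fun g => φ.symm ⟨y g, hyX g⟩ g with hp
  refine ⟨φ p, (φ p).2, fun g hg => ?_⟩
  have key : ∀ g : factors G X, φ p ⊓ ⟨g, le_of_mem_factors g.2⟩ = ⟨y g, hyX g⟩ := by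
    intro g
    have h1 : (⟨g, le_of_mem_factors g.2⟩ : Set.Iic X) = φ (Function.update ⊥ g ⊤) :=
      Subtype.ext (hφ g).symm
    have h2 : φ.symm ⟨y g, hyX g⟩ ≤ Function.update ⊥ g ⊤ := by
      rw [φ.symm_apply_le, ← h1]
      exact hy g g.2
    rw [h1, ← φ.map_inf, ← φ.eq_symm_apply]
    refine le_antisymm ?_ (le_inf ?_ h2)
    · intro k
      by_cases hk : k = g
      · subst hk
        exact inf_le_left
      · refine inf_le_right.trans ?_
        rw [Function.update_of_ne hk]
        exact bot_le
    · intro k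
      by_cases hk : k = g
      · subst hk
        exact le_rfl
      · refine (h2 k).trans ?_
        rw [Function.update_of_ne hk]
        exact bot_le
  exact congrArg Subtype.val (key ⟨g, hg⟩)

theorem ne_bot_of_mem_factors (hG : IsBuildingSet G) {g : L} (hg : g ∈ factors G X) : g ≠ ⊥ := by
  rintro rfl
  exact hG.1 (factors_subset hg)

theorem inf_eq_bot_of_mem_factors (hG : IsBuildingSet G) {g g' : L} (hg : g ∈ factors G X)
    (hg' : g' ∈ factors G X) (hne : g ≠ g') : g ⊓ g' = ⊥ := by
  classical
  have hX : X ≠ ⊥ := ne_bot_of_le_ne_bot (hG.ne_bot_of_mem_factors hg) (le_of_mem_factors hg)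
  obtain ⟨Y, -, hY⟩ := hG.exists_inf_factor_eq hX (y := fun k => if k = g then g else ⊥)
    (fun k _ => by
      split_ifs with h
      · exact h.ge
      · exact bot_le)
  have h1 := hY g hg
  have h2 := hY g' hg'
  rw [if_pos rfl, inf_eq_right] at h1
  rw [if_neg hne.symm] at h2
  exact le_bot_iff.1 ((inf_le_inf_right _ h1).trans h2.le)

/-- An element of a building set that meets a factor of `X` nontrivially lies below it. -/
theorem le_factor_of_inf_ne_bot [Finite L] (hG : IsBuildingSet G) {g : L}
    (hg : g ∈ factors G X) (hY : Y ∈ G) (hYX : Y ≤ X) (hne : Y ⊓ g ≠ ⊥) : Y ≤ g := by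
  obtain ⟨g', hg', hYg'⟩ := exists_le_factor hY hYX
  by_cases h : g' = g
  · exact h ▸ hYg'
  · exact absurd (le_bot_iff.1 ((inf_le_inf_right g hYg').trans
      (hG.inf_eq_bot_of_mem_factors hg' hg h).le)) hne

end IsBuildingSet

/-- The map `Y ↦ (Y ⊓ g)_g` reflects the order because every atom is seen by a factor, and it is
surjective by gluing; its inverse is the required isomorphism. -/
theorem isBuildingSet_of_atoms [IsAtomistic L] (hbot : ⊥ ∉ G)
    (hatom : ∀ X a : L, IsAtom a → a ≤ X → ∃ g ∈ factors G X, a ≤ g)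
    (hinf : ∀ X : L, X ≠ ⊥ → ∀ y : L → L, (∀ g ∈ factors G X, y g ≤ g) →
      ∃ Y ≤ X, ∀ g ∈ factors G X, Y ⊓ g = y g) : IsBuildingSet G := by
  classical
  refine ⟨hbot, fun X hX => ?_⟩
  have hdisj : ∀ g ∈ factors G X, ∀ g' ∈ factors G X, g' ≠ g → g ⊓ g' = ⊥ := by
    intro g hg g' hg' hne
    obtain ⟨Y, -, hY⟩ := hinf X hX (fun k => if k = g then g else ⊥) fun k _ => by
      split_ifs with h
      · exact h.ge
      · exact bot_le
    have h1 := hY g hg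
    have h2 := hY g' hg'
    rw [if_pos rfl, inf_eq_right] at h1
    rw [if_neg hne] at h2
    exact le_bot_iff.1 ((inf_le_inf_right _ h1).trans h2.le)
  let ψ : Set.Iic X ↪o (∀ g : factors G X, Set.Iic (g : L)) :=
    OrderEmbedding.ofMapLEIff (fun Y g => ⟨Y ⊓ g, inf_le_right⟩) fun Y Z => by
      refine ⟨fun h => ?_, fun h g => inf_le_inf_right (g : L) (show (Y : L) ≤ Z from h)⟩
      refine (le_iff_atom_le_imp (α := L)).2 fun a ha haY => ?_
      obtain ⟨g, hg, hag⟩ := hatom X a ha (haY.trans Y.2)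
      have hYZ : (Y : L) ⊓ g ≤ (Z : L) ⊓ g := h ⟨g, hg⟩
      exact (le_inf haY hag).trans (hYZ.trans inf_le_left)
  have hψ : Function.Surjective ψ := by
    intro p
    obtain ⟨Y, hYX, hY⟩ := hinf X hX (fun k => if hk : k ∈ factors G X then p ⟨k, hk⟩ else ⊥)
      fun g hg => by
        simp only [hg, dite_true]
        exact (p ⟨g, hg⟩).2
    refine ⟨⟨Y, hYX⟩, funext fun g => Subtype.ext ?_⟩
    have hYg := hY g g.2
    rw [dif_pos g.2] at hYg
    exact hYg
  refine ⟨(RelIso.ofSurjective ψ hψ).symm, fun g => ?_⟩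
  have : (RelIso.ofSurjective ψ hψ).symm (Function.update ⊥ g ⊤) =
      ⟨g, Set.mem_Iic.2 (le_of_mem_factors g.2)⟩ := by
    refine (RelIso.ofSurjective ψ hψ).injective
      (((RelIso.ofSurjective ψ hψ).apply_symm_apply _).trans ?_)
    funext k
    by_cases hk : k = g
    · subst hk
      rw [Function.update_self]
      exact Subtype.ext (inf_idem (k : L)).symm
    · rw [Function.update_of_ne hk]
      exact Subtype.ext (hdisj g g.2 k k.2 fun h => hk (Subtype.ext h)).symm
  rw [this]

/-- Removing a minimal element of `G \ H` from a building set `G ⊇ H` leaves a building set. -/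
theorem IsBuildingSet.diff_singleton [Finite L] [IsAtomistic L] (hG : IsBuildingSet G)
    (hH : IsBuildingSet H) (hHG : H ⊆ G) (hX : Minimal (fun Y => Y ∈ G \ H) X) :
    IsBuildingSet (G \ {X}) := by
  classical
  have hFX := factors_diff_singleton hHG hX
  have hXbot : X ≠ ⊥ := by
    rintro rfl
    exact hG.1 hX.prop.1
  have hother : ∀ Z g, g ∈ factors G Z → g ≠ X → g ∈ factors (G \ {X}) Z := fun Z g hg hne =>
    mem_factors.2 ⟨⟨⟨factors_subset hg, hne⟩, le_of_mem_factors hg⟩,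
      fun Y hY => (mem_factors.1 hg).2 Y hY.1⟩
  have hnew : ∀ Z, X ∈ factors G Z → ∀ f ∈ factors H X, f ∈ factors (G \ {X}) Z := by
    intro Z hXZ f hf
    rw [← hFX] at hf
    refine mem_factors.2 ⟨⟨factors_subset hf, (le_of_mem_factors hf).trans (le_of_mem_factors hXZ)⟩,
      fun Y hY hYZ hfY => (mem_factors.1 hf).2 Y hY ?_ hfY⟩
    -- `Y` and the factor `X` of `Z` share the nonzero lower bound `f`, so `Y ≤ X`, and maximality
    -- of `f` below `X` applies.
    refine hG.le_factor_of_inf_ne_bot hXZ hY.1 hYZ fun h0 => hG.1 ?_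
    have : f = ⊥ := le_bot_iff.1 ((le_inf hfY (le_of_mem_factors hf)).trans h0.le)
    exact this ▸ (factors_subset hf).1
  have hold : ∀ Z g, g ∈ factors (G \ {X}) Z →
      (g ∈ factors G Z) ∨ (X ∈ factors G Z ∧ g ∈ factors H X) := by
    intro Z g hg
    obtain ⟨g', hg', hgg'⟩ := exists_le_factor (factors_subset hg).1 (le_of_mem_factors hg)
    by_cases h : g' = X
    · rw [h] at hg' hgg'
      refine Or.inr ⟨hg', ?_⟩
      rw [← hFX]
      exact mem_factors.2 ⟨⟨factors_subset hg, hgg'⟩, fun Y hY hYX =>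
        (mem_factors.1 hg).2 Y hY (hYX.trans (le_of_mem_factors hg'))⟩
    · left
      rwa [eq_of_mem_factors hg ⟨factors_subset hg', h⟩ (le_of_mem_factors hg') hgg']
  refine isBuildingSet_of_atoms (fun h => hG.1 h.1) ?_ ?_
  · intro Z a ha haZ
    obtain ⟨g, hg, hag⟩ := hG.exists_atom_le_factor ha haZ
    by_cases h : g = X
    · subst h
      obtain ⟨f, hf, haf⟩ := hH.exists_atom_le_factor ha hag
      exact ⟨f, hnew Z hg f hf, haf⟩
    · exact ⟨g, hother Z g hg h, hag⟩
  · intro Z hZ y hy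
    by_cases hXZ : X ∈ factors G Z
    -- Gluing in two stages: the data on the factors of `X` give `W ≤ X`, which then serves as the
    -- datum at the factor `X` of `Z`.
    · obtain ⟨W, hWX, hW⟩ := hH.exists_inf_factor_eq hXbot fun f hf => hy f (hnew Z hXZ f hf)
      obtain ⟨Y, hYZ, hY⟩ := hG.exists_inf_factor_eq hZ (y := fun g => if g = X then W else y g)
        (fun g hg => by
          split_ifs with h
          · exact h ▸ hWX
          · exact hy g (hother Z g hg h))
      refine ⟨Y, hYZ, fun g hg => ?_⟩
      have hYX := hY X hXZ
      rw [if_pos rfl] at hYX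
      rcases hold Z g hg with h | ⟨-, h⟩
      · rw [hY g h, if_neg]
        rintro rfl
        exact (factors_subset hg).2 rfl
      · rw [← hW g h, ← hYX, inf_assoc, inf_eq_right.2 (le_of_mem_factors h)]
    · obtain ⟨Y, hYZ, hY⟩ := hG.exists_inf_factor_eq hZ (y := y) fun g hg =>
        hy g (hother Z g hg (by rintro rfl; exact hXZ hg))
      refine ⟨Y, hYZ, fun g hg => hY g ?_⟩
      exact (hold Z g hg).resolve_right fun h => hXZ h.1

end BuildingSet

/-! ### Nested sets in a partial order. -/

section NestedPartialOrder

theorem IsNested.mono {L : Type*} [PartialOrder L] {G S T : Set L}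
    (hS : IsNested G S) (hTS : T ⊆ S) : IsNested G T :=
  ⟨hTS.trans hS.1, fun A hA => hS.2 A (hA.trans hTS)⟩

theorem isNested_empty {L : Type*} [PartialOrder L] {G : Set L} : IsNested G ∅ :=
  ⟨Set.empty_subset _, fun _ hA hnt => absurd hnt.nonempty (by simp [Set.subset_empty_iff.1 hA])⟩

theorem isLUB_maximal_iff {L : Type*} [PartialOrder L] [Finite L] {S : Set L} {J : L} :
    IsLUB {x | Maximal (· ∈ S) x} J ↔ IsLUB S J := by
  have : upperBounds {x | Maximal (· ∈ S) x} = upperBounds S := by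
    refine Set.Subset.antisymm (fun b hb s hs => ?_) (upperBounds_mono_set fun x hx => hx.prop)
    obtain ⟨m, hsm, hm⟩ := (Set.toFinite S).exists_le_maximal hs
    exact hsm.trans (hb hm)
  rw [IsLUB, IsLUB, this]

theorem isNested_factors {L : Type*} [SemilatticeInf L] [Finite L] (B : Set L) (X : L) :
    IsNested B (factors B X) := by
  refine ⟨factors_subset, fun A hA hnt _ => ?_⟩
  obtain ⟨J, hJ⟩ := exists_isLUB_of_bddAbove (A := A) ⟨X, fun a ha => le_of_mem_factors (hA ha)⟩
  refine ⟨J, hJ, fun hJB => ?_⟩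
  obtain ⟨a, ha, b, hb, hab⟩ := hnt
  have hJX : J ≤ X := hJ.2 fun a ha => le_of_mem_factors (hA ha)
  exact hab ((eq_of_mem_factors (hA ha) hJB hJX (hJ.1 ha)).trans
    (eq_of_mem_factors (hA hb) hJB hJX (hJ.1 hb)).symm)

end NestedPartialOrder

/-! ### Joins of nested sets and uniqueness of conic representations. -/

section Nested

variable {L : Type*} [SemilatticeInf L] [OrderBot L] {G S T A B : Set L} {X Y J : L}

/-- A nonempty antichain in a nested set consists of the factors of its join. -/
theorem IsNested.factors_eq [Finite L] (hS : IsNested G S) (hG : IsBuildingSet G) (hAS : A ⊆ S)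
    (hA : IsAntichain (· ≤ ·) A) (hne : A.Nonempty) (hJ : IsLUB A J) : factors G J = A := by
  rcases hne.exists_eq_singleton_or_nontrivial with ⟨a, rfl⟩ | hnt
  · rw [hJ.unique isLUB_singleton]
    exact factors_of_mem (hS.1 (hAS rfl))
  have hJ0 : J ≠ ⊥ := by
    obtain ⟨a, ha⟩ := hne
    exact ne_bot_of_le_ne_bot (fun h => hG.1 (h ▸ hS.1 (hAS ha))) (hJ.1 ha)
  -- `y g` is the join of the part of `A` below `g`. Gluing these gives an upper bound of `A`, which
  -- forces `y g = g`. A factor outside `A` would then be the join of at least two incomparable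
  -- members of `S` while lying in `G`.
  have hlub : ∀ g, ∃ y, IsLUB {a ∈ A | a ≤ g} y := fun g =>
    exists_isLUB_of_bddAbove ⟨g, fun a ha => ha.2⟩
  choose y hy using hlub
  obtain ⟨Y, hYJ, hY⟩ := hG.exists_inf_factor_eq hJ0 (y := y) fun g _ => (hy g).2 fun a ha => ha.2
  have hJY : J ≤ Y := hJ.2 fun a ha => by
    obtain ⟨g, hg, hag⟩ := exists_le_factor (hS.1 (hAS ha)) (hJ.1 ha)
    exact ((hy g).1 ⟨ha, hag⟩).trans ((hY g hg).symm.le.trans inf_le_left)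
  have hyg : ∀ g ∈ factors G J, y g = g := fun g hg => by
    rw [← hY g hg, inf_eq_right]
    exact (le_of_mem_factors hg).trans hJY
  have hsub : factors G J ⊆ A := by
    intro g hg
    have hlub : IsLUB {a ∈ A | a ≤ g} g := by
      have := hy g
      rwa [hyg g hg] at this
    by_contra hgA
    have hsubA : {a ∈ A | a ≤ g} ⊆ A := Set.sep_subset _ _
    rcases Set.eq_empty_or_nonempty {a ∈ A | a ≤ g} with h0 | h0
    · rw [h0] at hlub
      exact hG.ne_bot_of_mem_factors hg (hlub.unique isLUB_empty)
    rcases h0.exists_eq_singleton_or_nontrivial with ⟨a, h1⟩ | h1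
    · rw [h1] at hlub
      have hag : g = a := hlub.unique isLUB_singleton
      exact hgA (hsubA (h1.symm ▸ hag))
    · obtain ⟨J', hJ', hJG⟩ := hS.2 _ (hsubA.trans hAS) h1 (hA.subset hsubA)
      exact hJG (hJ'.unique hlub ▸ factors_subset hg)
  refine hsub.antisymm fun a ha => ?_
  obtain ⟨g, hg, hag⟩ := exists_le_factor (hS.1 (hAS ha)) (hJ.1 ha)
  rwa [hA.eq ha (hsub hg) hag]

/-- Every nested set has a join. -/
theorem IsNested.exists_isLUB [Finite L] (hS : IsNested G S) : ∃ J, IsLUB S J := by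
  simp only [← isLUB_maximal_iff (S := S)]
  rcases Set.eq_empty_or_nonempty {x | Maximal (· ∈ S) x} with h0 | h0
  · exact ⟨⊥, h0 ▸ isLUB_empty⟩
  rcases h0.exists_eq_singleton_or_nontrivial with ⟨a, h1⟩ | h1
  · exact ⟨a, h1 ▸ isLUB_singleton⟩
  · obtain ⟨J, hJ, -⟩ := hS.2 _ (fun x hx => hx.prop) h1 (setOfPred_maximal_antichain _)
    exact ⟨J, hJ⟩

theorem IsNested.factors_eq_maximal [Finite L] (hS : IsNested G S) (hG : IsBuildingSet G)
    (hne : S.Nonempty) (hJ : IsLUB S J) : factors G J = {x | Maximal (· ∈ S) x} := by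
  obtain ⟨m, -, hm⟩ := (Set.toFinite S).exists_le_maximal hne.some_mem
  exact hS.factors_eq hG (fun x hx => hx.prop) (setOfPred_maximal_antichain _) ⟨m, hm⟩
    (isLUB_maximal_iff.2 hJ)

theorem sum_charVec_pos_iff [Fintype L] {c : L → ℝ} (hc : 0 ≤ c) (a : {A : L // IsAtom A}) :
    0 < (∑ Y, c Y • charVec Y) a ↔ ∃ Y, c Y ≠ 0 ∧ (a : L) ≤ Y := by
  classical
  have hval : ∀ Y, (c Y • charVec Y) a = if (a : L) ≤ Y then c Y else 0 := fun Y => by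
    simp [charVec, Set.indicator_apply]
  rw [Finset.sum_apply, Finset.sum_pos_iff_of_nonneg]
  · refine exists_congr fun Y => ?_
    rw [hval]
    split_ifs with h
    · simpa [h] using (hc Y).lt_iff_ne'
    · simp [h]
  · intro Y _
    rw [hval]
    split_ifs
    · exact hc Y
    · exact le_rfl

/-- The positive coordinates are the atoms below the join of the support, so both joins agree. Hence
both supports have the same maximal elements, which disjointness permits only if the supports are
empty. -/
theorem IsNested.eq_zero_of_sum_eq [Fintype L] [IsAtomistic L] (hG : IsBuildingSet G)
    {c d : L → ℝ} (hc : 0 ≤ c) (hd : 0 ≤ d) (hcG : IsNested G (Function.support c))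
    (hdG : IsNested G (Function.support d))
    (hsum : ∑ Y, c Y • charVec Y = ∑ Y, d Y • charVec Y)
    (hdisj : Disjoint (Function.support c) (Function.support d)) : c = 0 := by
  by_contra hc0
  have hiff : ∀ a : L, IsAtom a →
      ((∃ Y, c Y ≠ 0 ∧ a ≤ Y) ↔ (∃ Y, d Y ≠ 0 ∧ a ≤ Y)) := fun a ha => by
    rw [← sum_charVec_pos_iff hc ⟨a, ha⟩, hsum, sum_charVec_pos_iff hd ⟨a, ha⟩]
  have hcne : (Function.support c).Nonempty := Function.support_nonempty_iff.2 hc0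
  have hdne : (Function.support d).Nonempty := by
    obtain ⟨Y, hY⟩ := hcne
    obtain ⟨a, ha, haY⟩ := (eq_bot_or_exists_atom_le Y).resolve_left
      fun h => hG.1 (h ▸ hcG.1 hY)
    obtain ⟨Z, hZ, -⟩ := (hiff a ha).1 ⟨Y, hY, haY⟩
    exact ⟨Z, hZ⟩
  obtain ⟨J, hJ⟩ := hcG.exists_isLUB
  obtain ⟨K, hK⟩ := hdG.exists_isLUB
  have hJfac := hcG.factors_eq_maximal hG hcne hJ
  have hKfac := hdG.factors_eq_maximal hG hdne hK
  have hJK : J = K := by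
    refine eq_iff_atom_le_iff.2 fun a ha => ⟨fun haJ => ?_, fun haK => ?_⟩
    · obtain ⟨g, hg, hag⟩ := hG.exists_atom_le_factor ha haJ
      rw [hJfac] at hg
      obtain ⟨Z, hZ, haZ⟩ := (hiff a ha).1 ⟨g, hg.prop, hag⟩
      exact haZ.trans (hK.1 hZ)
    · obtain ⟨g, hg, hag⟩ := hG.exists_atom_le_factor ha haK
      rw [hKfac] at hg
      obtain ⟨Z, hZ, haZ⟩ := (hiff a ha).2 ⟨g, hg.prop, hag⟩
      exact haZ.trans (hJ.1 hZ)
  obtain ⟨m, -, hm⟩ := (Set.toFinite _).exists_le_maximal hcne.some_mem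
  have hmd : m ∈ {x | Maximal (· ∈ Function.support d) x} := by
    rw [← hKfac, ← hJK, hJfac]
    exact hm
  exact Set.disjoint_left.1 hdisj hm.prop hmd.prop

theorem IsBuildingSet.isConicRealization [Fintype L] [IsAtomistic L] (hG : IsBuildingSet G) :
    IsConicRealization {S : Set L | IsNested G S} charVec where
  empty_mem := isNested_empty
  mono _ _ hT hST := IsNested.mono hT hST
  inj c d hc hd hcG hdG hsum := by
    -- Subtracting the common part `c ⊓ d` reduces to disjoint supports.
    have hsub : ∑ Y, (c - c ⊓ d) Y • charVec Y = ∑ Y, (d - c ⊓ d) Y • charVec Y := by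
      simp only [Pi.sub_apply, sub_smul, Finset.sum_sub_distrib, hsum]
    have hc' : 0 ≤ c - c ⊓ d := sub_nonneg.2 inf_le_left
    have hd' : 0 ≤ d - c ⊓ d := sub_nonneg.2 inf_le_right
    have hcs : Function.support (c - c ⊓ d) ⊆ Function.support c := fun Y hY h0 =>
      hY (by simpa [h0] using hd Y)
    have hds : Function.support (d - c ⊓ d) ⊆ Function.support d := fun Y hY h0 =>
      hY (by simpa [h0] using hc Y)
    have hdisj : Disjoint (Function.support (c - c ⊓ d)) (Function.support (d - c ⊓ d)) := by
      refine Set.disjoint_left.2 fun Y hY hY' => ?_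
      rcases le_total (c Y) (d Y) with h | h
      · exact hY (by simp [h])
      · exact hY' (by simp [h])
    have h1 := IsNested.eq_zero_of_sum_eq hG hc' hd' (IsNested.mono hcG hcs)
      (IsNested.mono hdG hds) hsub hdisj
    have h2 := IsNested.eq_zero_of_sum_eq hG hd' hc' (IsNested.mono hdG hds)
      (IsNested.mono hcG hcs) hsub.symm hdisj.symm
    rw [sub_eq_zero.1 h1, ← sub_eq_zero.1 h2]

end Nested

/-! ### Nested sets after adding one element. -/

section Insert

variable {L : Type*} [SemilatticeInf L] [OrderBot L] {B S : Set L} {X : L}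

theorem IsBuildingSet.nontrivial_factors [Finite L] [IsAtomistic L] (hB : IsBuildingSet B)
    (hX : X ≠ ⊥) (hXB : X ∉ B) : (factors B X).Nontrivial := by
  obtain ⟨a, ha, haX⟩ := (eq_bot_or_exists_atom_le X).resolve_left hX
  obtain ⟨g, hg, -⟩ := hB.exists_atom_le_factor ha haX
  refine Set.Nonempty.exists_eq_singleton_or_nontrivial ⟨g, hg⟩ |>.resolve_left ?_
  rintro ⟨f, hf⟩
  have hfX : f ∈ factors B X := hf ▸ rfl
  refine hXB ((le_antisymm (le_iff_atom_le_imp.2 fun b hb hbX => ?_) (le_of_mem_factors hfX) :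
    X = f) ▸ factors_subset hfX)
  obtain ⟨k, hk, hbk⟩ := hB.exists_atom_le_factor hb hbX
  rw [hf] at hk
  exact (Set.mem_singleton_iff.1 hk) ▸ hbk

theorem IsBuildingSet.isLUB_factors [IsAtomistic L] (hB : IsBuildingSet B) (X : L) :
    IsLUB (factors B X) X := by
  refine ⟨fun f hf => le_of_mem_factors hf, fun b hb => le_iff_atom_le_imp.2 fun a ha haX => ?_⟩
  obtain ⟨g, hg, hag⟩ := hB.exists_atom_le_factor ha haX
  exact hag.trans (hb hg)

/-- The only new obstruction is an antichain with join `X`, and in a `B`-nested set such an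
antichain must be the set of factors of `X`. -/
theorem isNested_insert_iff_of_notMem [Finite L] [IsAtomistic L] (hB : IsBuildingSet B)
    (hX : X ≠ ⊥) (hXB : X ∉ B) (hXS : X ∉ S) :
    IsNested (insert X B) S ↔ IsNested B S ∧ ¬ factors B X ⊆ S := by
  constructor
  · intro h
    refine ⟨⟨fun s hs => ?_, fun A hA hnt hAC => ?_⟩, fun hF => ?_⟩
    · exact (h.1 hs).resolve_left (by rintro rfl; exact hXS hs)
    · obtain ⟨J, hJ, hJG⟩ := h.2 A hA hnt hAC
      exact ⟨J, hJ, fun hJB => hJG (Or.inr hJB)⟩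
    · obtain ⟨J, hJ, hJG⟩ := h.2 _ hF (hB.nontrivial_factors hX hXB) (isAntichain_factors B X)
      exact hJG (Or.inl (hJ.unique (hB.isLUB_factors X)))
  · rintro ⟨h, hF⟩
    refine ⟨fun s hs => Or.inr (h.1 hs), fun A hA hnt hAC => ?_⟩
    obtain ⟨J, hJ, hJB⟩ := h.2 A hA hnt hAC
    refine ⟨J, hJ, ?_⟩
    rintro (rfl | hJB')
    · exact hF (h.factors_eq hB hA hAC hnt.nonempty hJ ▸ hA)
    · exact hJB hJB'

/-- In both directions `X` is traded for its factors, which have join `X`. -/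
theorem isNested_insert_insert_iff [Finite L] [IsAtomistic L] (hB : IsBuildingSet B)
    (hG : IsBuildingSet (insert X B)) (hXB : X ∉ B) (hXS : X ∉ S) :
    IsNested (insert X B) (insert X S) ↔ ¬ factors B X ⊆ S ∧ IsNested B (S ∪ factors B X) := by
  have hX : X ≠ ⊥ := fun h => hG.1 (Or.inl h.symm)
  constructor
  · intro h
    have hS := (isNested_insert_iff_of_notMem hB hX hXB hXS).1 (h.mono (Set.subset_insert X S))
    refine ⟨hS.2, Set.union_subset hS.1.1 factors_subset, fun A hA hnt hAC => ?_⟩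
    by_cases hAS : A ⊆ S
    · exact hS.1.2 A hAS hnt hAC
    obtain ⟨f, hfA, hfS⟩ := Set.not_subset.1 hAS
    have hf : f ∈ factors B X := (hA hfA).resolve_left hfS
    have hfX := le_of_mem_factors hf
    have hf0 := hB.ne_bot_of_mem_factors hf
    obtain ⟨K, hK⟩ := h.exists_isLUB
    have hAK : K ∈ upperBounds A := fun a ha => (hA ha).elim (fun h => hK.1 (Or.inr h))
      fun h => (le_of_mem_factors h).trans (hK.1 (Or.inl rfl))
    obtain ⟨J, hJ⟩ := exists_isLUB_of_bddAbove ⟨K, hAK⟩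
    refine ⟨J, hJ, fun hJB => ?_⟩
    -- the elements of `A` that do not lie below `X`, together with `X`
    set A' := insert X {a ∈ A | ¬ a ≤ X} with hA'
    have hA'S : A' ⊆ insert X S := by
      rintro a (rfl | ⟨haA, haX⟩)
      · exact Or.inl rfl
      · exact Or.inr ((hA haA).resolve_right fun h => haX (le_of_mem_factors h))
    have hA'C : IsAntichain (· ≤ ·) A' := by
      refine (hAC.subset (Set.sep_subset A fun a => ¬ a ≤ X)).insert ?_ ?_
      · intro a ha _ haX
        exact ha.2 haX
      · intro a ha _ hXa
        have hfa : f = a := hAC.eq hfA ha.1 (hfX.trans hXa)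
        exact ha.2 (hfa ▸ hfX)
    obtain ⟨J', hJ'⟩ := (h.mono hA'S).exists_isLUB
    have hfac := h.factors_eq hG hA'S hA'C ⟨X, Or.inl rfl⟩ hJ'
    have hXfac : X ∈ factors (insert X B) J' := hfac ▸ Or.inl rfl
    have hJJ' : J ≤ J' := hJ.2 fun a ha => by
      by_cases haX : a ≤ X
      · exact haX.trans (hJ'.1 (Or.inl rfl))
      · exact hJ'.1 (Or.inr ⟨ha, haX⟩)
    -- `J` and the factor `X` of `J'` both lie above `f ≠ ⊥`, so `J ≤ X`. As `f` is a factor of `X`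
    -- and `J ∈ B`, this gives `f = J`, although `A` has another element.
    have hJX : J ≤ X := hG.le_factor_of_inf_ne_bot hXfac (Or.inr hJB) hJJ' fun h0 =>
      hf0 (le_bot_iff.1 ((le_inf (hJ.1 hfA) hfX).trans h0.le))
    have hfJ := eq_of_mem_factors hf hJB hJX (hJ.1 hfA)
    obtain ⟨b, hb, hbf⟩ := hnt.exists_ne f
    exact hbf (hAC.eq hb hfA (hfJ ▸ hJ.1 hb))
  · rintro ⟨hF, h⟩
    have hS := (isNested_insert_iff_of_notMem hB hX hXB hXS).2
      ⟨h.mono Set.subset_union_left, hF⟩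
    refine ⟨Set.insert_subset (Or.inl rfl) hS.1, fun A hA hnt hAC => ?_⟩
    by_cases hXA : X ∈ A
    swap
    · exact hS.2 A ((Set.subset_insert_iff_of_notMem hXA).1 hA) hnt hAC
    set A' := (A \ {X}) ∪ factors B X with hA'
    have hA'S : A' ⊆ S ∪ factors B X := Set.union_subset_union_left _ fun a ha =>
      (hA ha.1).resolve_left ha.2
    obtain ⟨J, hJ⟩ := (h.mono hA'S).exists_isLUB
    have hub : upperBounds A = upperBounds A' := by
      ext b
      constructor
      · rintro hb a (ha | ha)
        · exact hb ha.1
        · exact (le_of_mem_factors ha).trans (hb hXA)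
      · intro hb a ha
        by_cases haX : a = X
        · exact haX ▸ (hB.isLUB_factors X).2 fun f hf => hb (Or.inr hf)
        · exact hb (Or.inl ⟨ha, haX⟩)
    have hJA : IsLUB A J := by rwa [IsLUB, hub]
    refine ⟨J, hJA, ?_⟩
    obtain ⟨b, hbA, hbX⟩ := hnt.exists_ne X
    have hfac := (h.mono hA'S).factors_eq_maximal hB ⟨b, Or.inl ⟨hbA, hbX⟩⟩ hJ
    rintro (hJX | hJB)
    · exact hbX (hAC.eq hbA hXA (hJX ▸ hJA.1 hbA))
    -- A join in `B` would be its own only factor, hence a member of `A'`. It would lie above `X`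
    -- and `b`, so either another member of `A` lies above `X`, or a factor of `X` lies above `b`;
    -- both contradict the antichain.
    · rw [factors_of_mem hJB] at hfac
      have hJmax : J ∈ {x | Maximal (· ∈ A') x} := hfac ▸ rfl
      rcases hJmax.prop with hJ1 | hJ1
      · exact hJ1.2 (hAC.eq hXA hJ1.1 (hJA.1 hXA)).symm
      · exact hbX (hAC.eq hbA hXA ((hJA.1 hbA).trans (le_of_mem_factors hJ1)))

end Insert

/-! ### Blowups, stellar subdivisions and supports for one added element. -/

section BlowupIso

/-- An order isomorphism induces an isomorphism of the combinatorial blowups in corresponding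
elements. -/
def Blowup.congr {P Q : Type*} [PartialOrder P] [PartialOrder Q] (e : P ≃o Q) {x : P} {y : Q}
    (h : e x = y) : Blowup x ≃o Blowup y where
  toFun p := ⟨(e p.1.1, p.1.2), fun hle => p.2.1 (e.le_iff_le.1 (h.le.trans hle)), fun hp => by
    obtain ⟨z, hz⟩ := p.2.2 hp
    have hez := e.isLUB_image'.2 hz
    rw [Set.image_pair, h] at hez
    exact ⟨e z, hez⟩⟩
  invFun q := ⟨(e.symm q.1.1, q.1.2), fun hle => q.2.1 (h.ge.trans (e.le_symm_apply.1 hle)),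
    fun hq => by
    obtain ⟨z, hz⟩ := q.2.2 hq
    have hez := e.symm.isLUB_image'.2 hz
    rw [Set.image_pair, e.symm_apply_eq.2 h.symm] at hez
    exact ⟨e.symm z, hez⟩⟩
  left_inv p := Subtype.ext (Prod.ext (e.symm_apply_apply _) rfl)
  right_inv q := Subtype.ext (Prod.ext (e.apply_symm_apply _) rfl)
  map_rel_iff' {p q} := and_congr_left' e.le_iff_le

/-- Any common upper bound contains the union, and subsets of nested sets are nested. This turns the
condition for `ŷ` to be present into nestedness of a union. -/
theorem exists_isLUB_pair_iff {L : Type*} [PartialOrder L] {B : Set L} (S T : NestedSet B) :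
    (∃ z, IsLUB {S, T} z) ↔ IsNested B (S.1 ∪ T.1) := by
  constructor
  · rintro ⟨z, hz⟩
    exact z.2.mono (Set.union_subset (hz.1 (Or.inl rfl)) (hz.1 (Or.inr rfl)))
  · intro h
    refine ⟨⟨_, h⟩, ?_, fun z hz => ?_⟩
    · rintro _ (rfl | rfl)
      · exact Set.subset_union_left
      · exact Set.subset_union_right
    · exact Set.union_subset (hz (Or.inl rfl)) (hz (Or.inr rfl))

variable {L : Type*} [SemilatticeInf L] [OrderBot L] {B S T : Set L} {X : L}

theorem cone_insert (X : L) (S : Set L) : cone (insert X S) = joinRay (cone S) (charVec X) := by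
  rw [cone, Set.image_insert_eq, joinRay, sup_comm]
  exact Submodule.span_insert _ _

theorem cone_mono (h : S ⊆ T) : cone S ≤ cone T :=
  Submodule.span_mono (Set.image_mono h)

theorem cone_factors_mem [Finite L] (B : Set L) (X : L) : cone (factors B X) ∈ nestedFan B :=
  ⟨_, isNested_factors B X, rfl⟩

/-- Distinct factors meet in `⊥`, so each atom below `X` lies below exactly one factor. -/
theorem sum_indicator_factors [Fintype L] (hB : IsBuildingSet B) (X : L) :
    ∑ Y, (factors B X).indicator (1 : L → ℝ) Y • charVec Y = charVec X := by
  classical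
  funext a
  rw [Finset.sum_apply]
  by_cases haX : (a : L) ≤ X
  · obtain ⟨g, hg, hag⟩ := hB.exists_atom_le_factor a.2 haX
    rw [Finset.sum_eq_single g]
    · simp [charVec, hg, hag, haX]
    · intro Y _ hYg
      by_cases hY : Y ∈ factors B X
      · have : ¬ (a : L) ≤ Y := fun haY => a.2.1 (le_bot_iff.1
          ((le_inf haY hag).trans (hB.inf_eq_bot_of_mem_factors hY hg hYg).le))
        simp [charVec, Set.indicator_apply, this]
      · simp [hY]
    · simp
  · rw [Finset.sum_eq_zero]
    · simp [charVec, haX]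
    · intro Y _
      by_cases hY : Y ∈ factors B X
      · have : ¬ (a : L) ≤ Y := fun haY => haX (haY.trans (le_of_mem_factors hY))
        simp [charVec, Set.indicator_apply, this]
      · simp [hY]

theorem charVec_mem_cone_factors [Finite L] (hB : IsBuildingSet B) (X : L) :
    charVec X ∈ cone (factors B X) := by
  have := Fintype.ofFinite L
  exact mem_hull_image_iff.2 ⟨_, Set.indicator_nonneg fun _ _ => zero_le_one,
    Set.support_indicator_subset, sum_indicator_factors hB X⟩

variable [Finite L] [IsAtomistic L]

/-- Inserting `X` into a building set blows up the nested set complex in the factors of `X`. -/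
theorem exists_blowup_nestedSet (hB : IsBuildingSet B) (hG : IsBuildingSet (insert X B))
    (hXB : X ∉ B) :
    ∃ e : Blowup (⟨factors B X, isNested_factors B X⟩ : NestedSet B) ≃o NestedSet (insert X B),
      (∀ S h, (e (Blowup.base S h)).1 = S.1) ∧
      (∀ S h h', (e (Blowup.hat S h h')).1 = insert X S.1) := by
  have hX : X ≠ ⊥ := fun h => hG.1 (Or.inl h.symm)
  have hXS : ∀ S : NestedSet B, X ∉ S.1 := fun S h => hXB (S.2.1 h)
  let f : Blowup (⟨factors B X, isNested_factors B X⟩ : NestedSet B) → NestedSet (insert X B)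
    | ⟨(S, false), h⟩ => ⟨S.1, (isNested_insert_iff_of_notMem hB hX hXB (hXS S)).2 ⟨S.2, h.1⟩⟩
    | ⟨(S, true), h⟩ => ⟨insert X S.1, (isNested_insert_insert_iff hB hG hXB (hXS S)).2
        ⟨h.1, (exists_isLUB_pair_iff S _).1 (h.2 rfl)⟩⟩
  have hf : ∀ p q, f p ≤ f q ↔ p ≤ q := by
    rintro ⟨⟨S, _ | _⟩, h⟩ ⟨⟨T, _ | _⟩, h'⟩
    · exact ⟨fun hle => ⟨hle, le_rfl⟩, fun hle => hle.1⟩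
    · exact ⟨fun hle => ⟨(Set.subset_insert_iff_of_notMem (hXS S)).1 hle, Bool.false_le _⟩,
        fun hle => Set.Subset.trans hle.1 (Set.subset_insert _ _)⟩
    · exact ⟨fun hle => absurd (hle (Or.inl rfl)) (hXS T),
        fun hle => absurd (hle.2 rfl) Bool.false_ne_true⟩
    · exact ⟨fun hle => ⟨(Set.insert_subset_insert_iff (hXS S)).1 hle, le_rfl⟩,
        fun hle => Set.insert_subset_insert hle.1⟩
  have hsurj : Function.Surjective f := by
    rintro ⟨S, hS⟩
    by_cases hXS' : X ∈ S
    · obtain ⟨R, hXR, rfl⟩ : ∃ R, X ∉ R ∧ insert X R = S :=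
        ⟨S \ {X}, by simp, Set.insert_sdiff_self_of_mem hXS'⟩
      obtain ⟨h1, h2⟩ := (isNested_insert_insert_iff hB hG hXB hXR).1 hS
      exact ⟨⟨(⟨R, h2.mono Set.subset_union_left⟩, true), h1,
        fun _ => (exists_isLUB_pair_iff _ _).2 h2⟩, rfl⟩
    · obtain ⟨h1, h2⟩ := (isNested_insert_iff_of_notMem hB hX hXB hXS').1 hS
      exact ⟨⟨(⟨S, h1⟩, false), h2, fun h => absurd h Bool.false_ne_true⟩, rfl⟩
  exact ⟨RelIso.ofSurjective (OrderEmbedding.ofMapLEIff f hf) hsurj, fun _ _ => rfl,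
    fun _ _ _ => rfl⟩

theorem cone_le_cone_iff (hB : IsBuildingSet B) (hS : IsNested B S) (hT : IsNested B T) :
    cone S ≤ cone T ↔ S ⊆ T := by
  have := Fintype.ofFinite L
  exact hB.isConicRealization.hull_le_hull_iff hS hT

theorem IsBuildingSet.isSimplicialFan (hB : IsBuildingSet B) : IsSimplicialFan (nestedFan B) := by
  have := Fintype.ofFinite L
  exact hB.isConicRealization.isSimplicialFan

/-- The face poset of the nested set complex is the face poset of the nested set fan. -/
noncomputable def coneIso (hB : IsBuildingSet B) :
    NestedSet B ≃o {τ // τ ∈ nestedFan B} :=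
  RelIso.ofSurjective
    (OrderEmbedding.ofMapLEIff (fun S => ⟨cone S.1, S.1, S.2, rfl⟩)
      fun S T => cone_le_cone_iff hB S.2 T.2)
    fun ⟨_, S, hS, hσ⟩ => ⟨⟨S, hS⟩, Subtype.ext hσ.symm⟩

theorem cone_coneIso_symm (hB : IsBuildingSet B) (τ : {τ // τ ∈ nestedFan B}) :
    cone ((coneIso hB).symm τ).1 = τ.1 :=
  congrArg Subtype.val ((coneIso hB).apply_symm_apply τ)

/-- Inserting `X` into a building set blows up the face poset of the nested set fan. -/
theorem exists_blowup_nestedFan (hB : IsBuildingSet B) (hG : IsBuildingSet (insert X B))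
    (hXB : X ∉ B) :
    ∃ e : Blowup (⟨cone (factors B X), cone_factors_mem B X⟩ : {τ // τ ∈ nestedFan B}) ≃o
        {τ // τ ∈ nestedFan (insert X B)},
      (∀ τ h, (e (Blowup.base τ h)).1 = τ.1) ∧
      (∀ τ h h', (e (Blowup.hat τ h h')).1 = joinRay τ.1 (charVec X)) := by
  obtain ⟨e, hbase, hhat⟩ := exists_blowup_nestedSet hB hG hXB
  have hF : (coneIso hB).symm ⟨cone (factors B X), cone_factors_mem B X⟩ =
      ⟨factors B X, isNested_factors B X⟩ :=
    (coneIso hB).symm_apply_eq.2 rfl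
  refine ⟨((Blowup.congr (coneIso hB).symm hF).trans e).trans (coneIso hG),
    fun τ h => ?_, fun τ h h' => ?_⟩
  · change cone (e _).1 = τ.1
    rw [← cone_coneIso_symm hB τ]
    exact congrArg cone (hbase ((coneIso hB).symm τ)
      ((Blowup.congr (coneIso hB).symm hF (Blowup.base τ h)).2.1))
  · change cone (e _).1 = _
    rw [← cone_coneIso_symm hB τ, ← cone_insert]
    exact congrArg cone (hhat ((coneIso hB).symm τ)
      ((Blowup.congr (coneIso hB).symm hF (Blowup.hat τ h h')).2.1)
      ((Blowup.congr (coneIso hB).symm hF (Blowup.hat τ h h')).2.2 rfl))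

/-- Inclusion of cones is inclusion of nested sets, so the stellar conditions become the two
nestedness criteria; the cone of `R ∪ F`, with `F` the factors of `X`, is the member containing both
`R` and `F`. -/
theorem nestedFan_insert (hB : IsBuildingSet B) (hG : IsBuildingSet (insert X B)) (hXB : X ∉ B) :
    nestedFan (insert X B) = stellar (nestedFan B) (cone (factors B X)) (charVec X) := by
  have hX : X ≠ ⊥ := fun h => hG.1 (Or.inl h.symm)
  have hF := isNested_factors B X
  ext κ
  constructor
  · rintro ⟨S, hS, rfl⟩
    by_cases hXS : X ∈ S
    · obtain ⟨R, hXR, rfl⟩ : ∃ R, X ∉ R ∧ insert X R = S :=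
        ⟨S \ {X}, by simp, Set.insert_sdiff_self_of_mem hXS⟩
      obtain ⟨h1, h2⟩ := (isNested_insert_insert_iff hB hG hXB hXR).1 hS
      have hR := h2.mono Set.subset_union_left
      exact Or.inr ⟨_, ⟨_, h2, rfl⟩, cone_mono Set.subset_union_right, _, ⟨R, hR, rfl⟩,
        cone_mono Set.subset_union_left, fun h => h1 ((cone_le_cone_iff hB hF hR).1 h),
        cone_insert X R⟩
    · obtain ⟨h1, h2⟩ := (isNested_insert_iff_of_notMem hB hX hXB hXS).1 hS
      exact Or.inl ⟨⟨S, h1, rfl⟩, fun h => h2 ((cone_le_cone_iff hB hF h1).1 h)⟩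
  · rintro (⟨⟨S, hS, rfl⟩, hn⟩ | ⟨_, ⟨T, hT, rfl⟩, hσ, _, ⟨R, hR, rfl⟩, hle, hn, rfl⟩)
    · exact ⟨S, (isNested_insert_iff_of_notMem hB hX hXB fun h => hXB (hS.1 h)).2
        ⟨hS, fun h => hn (cone_mono h)⟩, rfl⟩
    · refine ⟨insert X R, (isNested_insert_insert_iff hB hG hXB fun h => hXB (hR.1 h)).2
        ⟨fun h => hn (cone_mono h), hT.mono (Set.union_subset ?_ ?_)⟩, (cone_insert X R).symm⟩
      · exact (cone_le_cone_iff hB hR hT).1 hle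
      · exact (cone_le_cone_iff hB hF hT).1 hσ

theorem isStellarSubdivision_insert (hB : IsBuildingSet B) (hG : IsBuildingSet (insert X B))
    (hXB : X ∉ B) :
    IsStellarSubdivision (nestedFan B) (cone (factors B X)) (charVec X)
      (nestedFan (insert X B)) where
  mem := cone_factors_mem B X
  ne_bot h := by
    have hX : X ≠ ⊥ := fun h => hG.1 (Or.inl h.symm)
    have hsub := (cone_le_cone_iff hB (isNested_factors B X) isNested_empty).1
      (h.le.trans bot_le)
    exact (hB.nontrivial_factors hX hXB).nonempty.ne_empty (Set.subset_empty_iff.1 hsub)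
  relint := by
    have := Fintype.ofFinite L
    rw [← sum_indicator_factors hB X]
    refine sum_mem_intrinsicInterior (hB.isConicRealization.linearIndepOn (isNested_factors B X))
      Set.support_indicator_subset fun i hi => ?_
    simp [hi]
  eq := nestedFan_insert hB hG hXB

theorem support_nestedFan_insert (hB : IsBuildingSet B) (hG : IsBuildingSet (insert X B))
    (hXB : X ∉ B) : support (nestedFan (insert X B)) = support (nestedFan B) := by
  classical
  have := Fintype.ofFinite L
  have hX : X ≠ ⊥ := fun h => hG.1 (Or.inl h.symm)
  ext x
  simp only [support, Set.mem_iUnion]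
  constructor
  · rintro ⟨_, ⟨S, hS, rfl⟩, hx⟩
    by_cases hXS : X ∈ S
    · obtain ⟨R, hXR, rfl⟩ : ∃ R, X ∉ R ∧ insert X R = S :=
        ⟨S \ {X}, by simp, Set.insert_sdiff_self_of_mem hXS⟩
      obtain ⟨-, h2⟩ := (isNested_insert_insert_iff hB hG hXB hXR).1 hS
      refine ⟨_, ⟨_, h2, rfl⟩, ?_⟩
      have hle : cone (insert X R) ≤ cone (R ∪ factors B X) := by
        rw [cone_insert, joinRay]
        refine sup_le (cone_mono Set.subset_union_left) (Submodule.span_le.2 ?_)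
        exact Set.singleton_subset_iff.2
          (cone_mono Set.subset_union_right (charVec_mem_cone_factors hB X))
      exact hle hx
    · exact ⟨_, ⟨S, ((isNested_insert_iff_of_notMem hB hX hXB hXS).1 hS).1, rfl⟩, hx⟩
  · rintro ⟨_, ⟨T, hT, rfl⟩, hx⟩
    by_cases hF : factors B X ⊆ T
    · obtain ⟨c, hc, hcT, rfl⟩ := mem_hull_image_iff.1 hx
      -- The least coefficient on the factors is moved to `v_X`: the other coefficients stay
      -- nonnegative and that of `f` vanishes, so the vector lies in the cone of `(T \ {f}) ∪ {X}`.
      obtain ⟨f, hf, hmin⟩ := Set.exists_min_image (factors B X) c (Set.toFinite _)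
        (hB.nontrivial_factors hX hXB).nonempty
      have hXT : X ∉ T \ {f} := fun h => hXB (hT.1 h.1)
      refine ⟨_, ⟨insert X (T \ {f}), (isNested_insert_insert_iff hB hG hXB hXT).2
        ⟨fun h => (h hf).2 rfl, hT.mono (Set.union_subset Set.sdiff_subset hF)⟩, rfl⟩, ?_⟩
      set F := factors B X with hFdef
      have hsum : ∑ Y, c Y • charVec Y =
          (∑ Y, (c Y - c f * F.indicator 1 Y) • charVec Y) + c f • charVec X := by
        rw [← sum_indicator_factors hB X, Finset.smul_sum, ← Finset.sum_add_distrib]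
        refine Finset.sum_congr rfl fun Y _ => ?_
        rw [smul_smul, ← add_smul, sub_add_cancel]
      rw [hsum, cone_insert, joinRay]
      refine Submodule.add_mem_sup (mem_hull_image_iff.2
        ⟨fun Y => c Y - c f * F.indicator 1 Y, fun Y => ?_, fun Y hY => ⟨?_, ?_⟩, rfl⟩)
        (PointedCone.smul_mem _ (hc f) (Submodule.subset_span rfl))
      · by_cases hYF : Y ∈ F
        · simpa [hYF] using hmin Y hYF
        · simpa [hYF] using hc Y
      · by_cases hYF : Y ∈ F
        · exact hF hYF
        · exact hcT (by simpa [hYF] using hY)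
      · rintro rfl
        exact hY (by simp [hf])
    · exact ⟨_, ⟨T, (isNested_insert_iff_of_notMem hB hX hXB fun h => hXB (hT.1 h)).2
        ⟨hT, hF⟩, rfl⟩, hx⟩

end BlowupIso

/-! ### The chain of building sets. -/

section Chain

variable {L : Type*} [SemilatticeInf L] [OrderBot L] [Finite L] [IsAtomistic L] {G H : Set L}

/-- Between two building sets there is a chain of building sets in which each member arises from
the next one by removing an element that is minimal outside the smallest member. -/
theorem exists_buildingSet_chain (hG : IsBuildingSet G) (hH : IsBuildingSet H) (hHG : H ⊆ G) :
    ∃ (t : ℕ) (B : ℕ → Set L), B 0 = H ∧ B t = G ∧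
      (∀ i ≤ t, IsBuildingSet (B i) ∧ H ⊆ B i) ∧
      ∀ i < t, ∃ X, Minimal (fun Y => Y ∈ B (i + 1) \ H) X ∧ B i = B (i + 1) \ {X} := by
  induction hn : (G \ H).ncard generalizing G with
  | zero =>
    have hGH : G = H :=
      (Set.sdiff_eq_empty.1 ((Set.ncard_eq_zero (Set.toFinite _)).1 hn)).antisymm hHG
    exact ⟨0, fun _ => H, rfl, hGH.symm, fun _ _ => ⟨hH, Set.Subset.rfl⟩, fun i hi => by omega⟩
  | succ n ih =>
    obtain ⟨Y, hY⟩ : (G \ H).Nonempty := Set.nonempty_of_ncard_ne_zero (by omega)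
    obtain ⟨X, -, hX⟩ := (Set.toFinite (G \ H)).exists_le_minimal hY
    have hHB : H ⊆ G \ {X} := Set.subset_sdiff_singleton hHG hX.prop.2
    have hcard : ((G \ {X}) \ H).ncard = n := by
      rw [Set.sdiff_sdiff_comm, Set.ncard_sdiff_singleton_of_mem hX.prop, hn, Nat.add_sub_cancel]
    obtain ⟨t, B, h0, ht, hB, hstep⟩ := ih (hG.diff_singleton hH hHG hX) hHB hcard
    -- The chain for `G \ {X}` is continued by `G`; values beyond index `t + 1` play no role.
    refine ⟨t + 1, fun i => if i ≤ t then B i else G, by simp [h0], by simp, fun i hi => ?_,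
      fun i hi => ?_⟩
    · by_cases hit : i ≤ t
      · simpa [hit] using hB i hit
      · simpa [hit] using ⟨hG, hHG⟩
    · rcases (Nat.lt_succ_iff.1 hi).lt_or_eq with hit | rfl
      · simpa [hit.le, Nat.succ_le_of_lt hit] using hstep i hit
      · exact ⟨X, by simpa using hX, by simpa using ht⟩

end Chain

end NestedSetFan

theorem theorem4p2 {L : Type*} [SemilatticeInf L] [OrderBot L] [Finite L] [IsAtomistic L]
    (G H : Set L) (hG : NestedSetFan.IsBuildingSet G) (hH : NestedSetFan.IsBuildingSet H)
    (hHG : H ⊆ G) :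
    -- a sequence of building sets from `H` to `G`, each defining a simplicial fan
    (∃ (t : ℕ) (B : ℕ → Set L), B 0 = H ∧ B t = G ∧
      (∀ i ≤ t, NestedSetFan.IsBuildingSet (B i) ∧
        NestedSetFan.IsSimplicialFan (NestedSetFan.nestedFan (B i))) ∧
      ∀ i < t, ∃ X : L,
        -- `B i` is obtained from `B (i + 1)` by removing a minimal element `X` of `B (i + 1) \ H`
        Minimal (fun Y => Y ∈ B (i + 1) \ H) X ∧ B i = B (i + 1) \ {X} ∧
        -- the fan of `B (i + 1)` is a stellar subdivision of the fan of `B i`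
        NestedSetFan.IsStellarSubdivision (NestedSetFan.nestedFan (B i))
          (NestedSetFan.cone (NestedSetFan.factors H X)) (NestedSetFan.charVec X)
          (NestedSetFan.nestedFan (B (i + 1))) ∧
        -- the face poset of the fan changes by a combinatorial blowup
        (∃ hσ : NestedSetFan.cone (NestedSetFan.factors H X) ∈ NestedSetFan.nestedFan (B i),
          ∃ e : NestedSetFan.Blowup
              (⟨NestedSetFan.cone (NestedSetFan.factors H X), hσ⟩ :
                {τ // τ ∈ NestedSetFan.nestedFan (B i)}) ≃o
              {τ // τ ∈ NestedSetFan.nestedFan (B (i + 1))},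
            (∀ τ h, (e (NestedSetFan.Blowup.base τ h)).1 = τ.1) ∧
            (∀ τ h h', (e (NestedSetFan.Blowup.hat τ h h')).1 =
              NestedSetFan.joinRay τ.1 (NestedSetFan.charVec X))) ∧
        -- and so does the face poset of the nested set complex
        (∃ hF : NestedSetFan.IsNested (B i) (NestedSetFan.factors H X),
          ∃ e : NestedSetFan.Blowup
              (⟨NestedSetFan.factors H X, hF⟩ : NestedSetFan.NestedSet (B i)) ≃o
              NestedSetFan.NestedSet (B (i + 1)),
            (∀ S h, (e (NestedSetFan.Blowup.base S h)).1 = S.1) ∧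
            (∀ S h h', (e (NestedSetFan.Blowup.hat S h h')).1 = insert X S.1))) ∧
    NestedSetFan.support (NestedSetFan.nestedFan G) =
      NestedSetFan.support (NestedSetFan.nestedFan H) := by
  obtain ⟨t, B, h0, ht, hB, hstep⟩ := NestedSetFan.exists_buildingSet_chain hG hH hHG
  have hinsert : ∀ i < t, ∃ X, Minimal (fun Y => Y ∈ B (i + 1) \ H) X ∧ B i = B (i + 1) \ {X} ∧
      X ∉ B i ∧ B (i + 1) = insert X (B i) ∧
      NestedSetFan.factors H X = NestedSetFan.factors (B i) X := by
    intro i hi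
    obtain ⟨X, hX, hBX⟩ := hstep i hi
    refine ⟨X, hX, hBX, by simp [hBX], ?_, ?_⟩
    · rw [hBX, Set.insert_sdiff_self_of_mem hX.prop.1]
    · rw [hBX, NestedSetFan.factors_diff_singleton (hB (i + 1) hi).2 hX]
  refine ⟨⟨t, B, h0, ht, fun i hi => ⟨(hB i hi).1, (hB i hi).1.isSimplicialFan⟩,
    fun i hi => ?_⟩, ?_⟩
  · obtain ⟨X, hX, hBX, hXB, hins, hF⟩ := hinsert i hi
    have hBi := (hB i hi.le).1
    have hBs := (hB (i + 1) hi).1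
    refine ⟨X, hX, hBX, ?_⟩
    rw [hins] at hBs
    -- The factors of `X` in `H` and in `B i` coincide, so the results on adding one element to `B
    -- i` apply.
    rw [hF, hins]
    exact ⟨NestedSetFan.isStellarSubdivision_insert hBi hBs hXB,
      ⟨_, NestedSetFan.exists_blowup_nestedFan hBi hBs hXB⟩,
      ⟨_, NestedSetFan.exists_blowup_nestedSet hBi hBs hXB⟩⟩
  · have hsupp : ∀ i ≤ t, NestedSetFan.support (NestedSetFan.nestedFan (B i)) =
        NestedSetFan.support (NestedSetFan.nestedFan H) := by
      intro i
      induction i with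
      | zero => rw [h0]; exact fun _ => rfl
      | succ i ih =>
        intro hi
        obtain ⟨X, -, -, hXB, hins, -⟩ := hinsert i hi
        have hBs := (hB (i + 1) hi).1
        rw [hins] at hBs
        rw [← ih (Nat.le_of_succ_le hi), hins,
          NestedSetFan.support_nestedFan_insert (hB i (Nat.le_of_succ_le hi)).1 hBs hXB]
    rw [← ht]
    exact hsupp t le_rfl
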